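/- Fix $\alpha>1$. A job sequence is a finite set of jobs with distinct ids; job $j$ has a release time $r(j)\ge 0$ and a work requirement $p(j)>0$. A single processor processes $s$ units of work and uses $P(s)=s^\alpha$ units of energy per unit time when it runs at speed $s\in[0,\infty)$; preemption is free, and the speed may be divided among several jobs. In a schedule, a job is *active* at time $t$ if it is released by time $t$ but not completed by time $t$; only active jobs are processed. The flow time of a job is the time from its release to its completion, and the cost of a schedule is its total flow time $\sum_j F(j)$ plus its energy $\int_0^\infty s(t)^\alpha\,dt$. An algorithm is $c$-competitive ($c\ge 1$) for total flow time plus energy if, for every job sequence $I$, the cost of the schedule it produces for $I$ is at most $c$ times the minimum (infimum) cost over all schedules of $I$. The algorithm $\mathrm{LAPS}(\delta,\beta)$ does the following at every time $t$, where $n(t)$ is the number of its active jobs: it runs the processor at speed $(1+\delta)\,n(t)^{1/\alpha}$ and splits this speed equally among the $\lceil\beta n(t)\rceil$ active jobs with the latest release times, ties being broken by job ids. (It is nonclairvoyant: the rule does not use the work requirements of the active jobs.) **Theorem.** For every $\alpha>1$, $\delta=\frac{3}{\alpha}$ and $\beta=\frac1{2\alpha}$, the rule $\mathrm{LAPS}(\delta,\beta)$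 determines exactly one schedule for every job sequence, and the resulting algorithm is $c$-competitive for total flow time plus energy, where \[ c = 4\alpha^3\Bigl(1+\bigl(1+\tfrac{3}{\alpha}\bigr)^\alpha\Bigr) = O(\alpha^3), \] the constant in $O(\alpha^3)$ being the same for all $\alpha>1$. -/

import Mathlib

open scoped ENNReal

noncomputable section

namespace SpeedScaling

/-- A finite job sequence. Jobs are identified with their ids `0, …, size - 1`; job `j` is
released at time `release j` and requires `work j` units of work. -/
structure JobSequence where
  size : ℕ
  release : Fin size → ℝ
  work : Fin size → ℝ
  release_nonneg : ∀ j, 0 ≤ release j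
  work_pos : ∀ j, 0 < work j

/-- The amount of work done by time `t` on a job that is processed at rate `x u` at time `u`. -/
def workDone (x : ℝ → ℝ) (t : ℝ) : ℝ := ∫ u in (0 : ℝ)..t, x u

/-- A (preemptive, single processor) schedule of `I`: `rate j t` is the rate at which job `j` is
processed at time `t`. A job is processed only while it is active, that is, released but not yet
completed. Several jobs may share the processor. -/
@[ext]
structure Schedule (I : JobSequence) where
  rate : Fin I.size → ℝ → ℝ
  rate_nonneg : ∀ j t, 0 ≤ rate j t
  rate_integrable : ∀ j t, IntervalIntegrable (rate j) MeasureTheory.volume 0 t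
  rate_eq_zero : ∀ j t, ¬ (I.release j ≤ t ∧ workDone (rate j) t < I.work j) → rate j t = 0

namespace Schedule

variable {I : JobSequence}

/-- The speed of the processor at time `t`: the work processed per unit time. -/
def speed (S : Schedule I) (t : ℝ) : ℝ := ∑ j, S.rate j t

/-- Job `j` has been completed by time `t`. -/
def CompletedBy (S : Schedule I) (j : Fin I.size) (t : ℝ) : Prop :=
  I.work j ≤ workDone (S.rate j) t

open Classical in
/-- The set of active jobs at time `t`: released by time `t` but not completed by time `t`. -/
def active (S : Schedule I) (t : ℝ) : Finset (Fin I.size) :=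
  Finset.univ.filter fun j => I.release j ≤ t ∧ ¬ S.CompletedBy j t

/-- The flow time of job `j`: the time elapsed from its release until its completion
(`∞` if it is never completed). -/
def flowTime (S : Schedule I) (j : Fin I.size) : ℝ≥0∞ :=
  ⨅ (t : ℝ) (_ : I.release j ≤ t ∧ S.CompletedBy j t), ENNReal.ofReal (t - I.release j)

/-- The total flow time. -/
def totalFlow (S : Schedule I) : ℝ≥0∞ := ∑ j, S.flowTime j

/-- The energy used when the power function is `P(s) = s ^ α`. -/
def energy (α : ℝ) (S : Schedule I) : ℝ≥0∞ :=
  ∫⁻ t in Set.Ici (0 : ℝ), ENNReal.ofReal (S.speed t ^ α)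

/-- The objective: total flow time plus energy. -/
def cost (α : ℝ) (S : Schedule I) : ℝ≥0∞ := S.totalFlow + S.energy α

end Schedule

/-- The optimal offline cost: the infimum of the cost over all schedules of `I`. -/
def optCost (α : ℝ) (I : JobSequence) : ℝ≥0∞ := ⨅ S : Schedule I, S.cost α

/-- `ALG`, which produces the schedule `ALG I` for the job sequence `I`, is `c`-competitive for
total flow time plus energy. -/
def IsCompetitive (α c : ℝ) (ALG : (I : JobSequence) → Schedule I) : Prop :=
  1 ≤ c ∧ ∀ I : JobSequence, (ALG I).cost α ≤ ENNReal.ofReal c * optCost α I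

/-- Job `k` is later than job `j`: it has a later release time, ties being broken by job ids. -/
def Later {m : ℕ} (release : Fin m → ℝ) (k j : Fin m) : Prop :=
  release j < release k ∨ (release j = release k ∧ j < k)

open Classical in
/-- The `k` latest jobs of the set `A`: those jobs of `A` for which fewer than `k` jobs of `A`
are later. -/
def latest {m : ℕ} (release : Fin m → ℝ) (A : Finset (Fin m)) (k : ℕ) : Finset (Fin m) :=
  A.filter fun j => (A.filter fun i => Later release i j).card < k

/-- The schedule `S` follows LAPS(δ, β) at every time `t`: with `n` active jobs the speed is
`(1 + δ) n ^ (1 / α)`, and it is shared equally by the `⌈β n⌉` latest active jobs. -/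
structure FollowsLAPS (α δ β : ℝ) {I : JobSequence} (S : Schedule I) : Prop where
  speed_eq : ∀ t, S.speed t = (1 + δ) * ((S.active t).card : ℝ) ^ (1 / α)
  rate_eq_of_mem : ∀ t, ∀ j ∈ latest I.release (S.active t) ⌈β * ((S.active t).card : ℝ)⌉₊,
    S.rate j t = S.speed t / (⌈β * ((S.active t).card : ℝ)⌉₊ : ℝ)
  rate_eq_of_notMem : ∀ t, ∀ j ∉ latest I.release (S.active t) ⌈β * ((S.active t).card : ℝ)⌉₊,
    S.rate j t = 0

end SpeedScaling

end

/-! Existence and uniqueness: the rates prescribed by LAPS depend only on the set of active jobs,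
and that set changes finitely often and is right-continuous in time. So a schedule can be built from
one event to the next, and two schedules that have agreed so far must agree a little longer.

Competitiveness: fix a competitor `O` and let the lag of job `j` be the work `O` has done on it
minus the work LAPS has done. Weight `j` by `rank ^ (1 - 1/α)`, where the rank counts the active
LAPS jobs that are not later than `j`. This is the usual potential argument in integrated form. The
positive part of the lag starts at 0 and stays nonnegative, and after the release of `j` its weight
only decreases, because jobs that are not later than `j` can only leave. Hence the weighted integral
of the growth of the positive lag is nonnegative (`integral_rank_mul_lag_nonneg`), and no jump of a
potential needs to be examined.

On the other hand, at each time this weighted growth is bounded by `s^α/α - (2/α) n + (2α+6) n_O`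
(`sum_rank_mul_sub_le`), where `s` and `n_O` are the competitor's speed and number of active jobs
and `n` is that of LAPS. Young's inequality bounds the competitor's contribution. Most of the jobs
LAPS processes have rank close to `n` and lag behind, and the excess speed `1 + 3/α` makes the
coefficient of `n` negative. Integration bounds the flow time of LAPS by `4α³` times the
competitor's cost. The energy of LAPS is exactly `(1 + 3/α)^α` times its flow time, which gives the
last factor of the ratio; that power is at most `e³`. -/

open scoped Topology
open MeasureTheory Set Filter

noncomputable section

namespace SpeedScaling

/-! ### Existence and uniqueness for rates determined by the active set -/

section Dynamics

variable {m : ℕ}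

/-- A family of nonnegative, locally integrable processing rates. -/
structure Admissible (x : Fin m → ℝ → ℝ) : Prop where
  nonneg : ∀ j t, 0 ≤ x j t
  integrable : ∀ j t, IntervalIntegrable (x j) volume 0 t

open Classical in
/-- The jobs that are released but not completed at time `t` under the rates `x`. -/
def activeSet (r p : Fin m → ℝ) (x : Fin m → ℝ → ℝ) (t : ℝ) : Finset (Fin m) :=
  Finset.univ.filter fun j => r j ≤ t ∧ workDone (x j) t < p j

theorem mem_activeSet {r p : Fin m → ℝ} {x : Fin m → ℝ → ℝ} {t : ℝ} {j : Fin m} :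
    j ∈ activeSet r p x t ↔ r j ≤ t ∧ workDone (x j) t < p j := by
  simp [activeSet]

theorem intervalIntegrable_of_zero {g : ℝ → ℝ} (hg : ∀ t, IntervalIntegrable g volume 0 t)
    (a b : ℝ) : IntervalIntegrable g volume a b :=
  (hg a).symm.trans (hg b)

theorem workDone_continuous {g : ℝ → ℝ} (hg : ∀ t, IntervalIntegrable g volume 0 t) :
    Continuous (workDone g) :=
  intervalIntegral.continuous_primitive (intervalIntegrable_of_zero hg) 0

theorem workDone_add_integral {g : ℝ → ℝ} (hg : ∀ t, IntervalIntegrable g volume 0 t)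
    (a b : ℝ) : workDone g b = workDone g a + ∫ u in a..b, g u :=
  (intervalIntegral.integral_add_adjacent_intervals (hg a)
    (intervalIntegrable_of_zero hg a b)).symm

theorem workDone_monotone {g : ℝ → ℝ} (hg : ∀ t, IntervalIntegrable g volume 0 t)
    (h0 : ∀ t, 0 ≤ g t) : Monotone (workDone g) := by
  intro a b hab
  rw [workDone_add_integral hg a b]
  have := intervalIntegral.integral_nonneg hab (fun u _ => h0 u) (μ := volume)
  linarith

theorem workDone_congr_of_lt {g h : ℝ → ℝ} {T t : ℝ} (hT : 0 ≤ T) (htT : t ≤ T)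
    (hgh : ∀ u < T, g u = h u) : workDone g t = workDone h t := by
  apply intervalIntegral.integral_congr_ae
  have hne : ∀ᵐ u : ℝ, u ≠ T := by simp [ae_iff]
  filter_upwards [hne] with u hu hmem
  refine hgh u (lt_of_le_of_ne ?_ hu)
  rw [uIoc, mem_Ioc] at hmem
  exact hmem.2.trans (max_le hT htT)

theorem activeSet_congr_of_lt {r p : Fin m → ℝ} {x y : Fin m → ℝ → ℝ} {T t : ℝ} (hT : 0 ≤ T)
    (htT : t ≤ T) (hxy : ∀ j, ∀ u < T, x j u = y j u) :
    activeSet r p x t = activeSet r p y t := by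
  ext j
  rw [mem_activeSet, mem_activeSet, workDone_congr_of_lt hT htT (hxy j)]

/-- The set of active jobs is right-continuous in time. -/
theorem activeSet_eventually_eq (r p : Fin m → ℝ) {x : Fin m → ℝ → ℝ} (hx : Admissible x)
    (T : ℝ) : ∀ᶠ t in 𝓝[≥] T, activeSet r p x t = activeSet r p x T := by
  have key : ∀ j : Fin m, ∀ᶠ t in 𝓝[≥] T,
      (j ∈ activeSet r p x t ↔ j ∈ activeSet r p x T) := by
    intro j
    simp only [mem_activeSet]
    have hc := workDone_continuous (hx.integrable j)
    have hge : ∀ᶠ t in 𝓝[≥] T, T ≤ t := self_mem_nhdsWithin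
    rcases le_or_gt (r j) T with hr | hr
    · rcases lt_or_ge (workDone (x j) T) (p j) with hw | hw
      · have h1 : ∀ᶠ t in 𝓝[≥] T, workDone (x j) t < p j :=
          nhdsWithin_le_nhds (hc.continuousAt.eventually_lt continuousAt_const hw)
        filter_upwards [h1, hge] with t h1 h2
        simp [h1, hr, hr.trans h2, hw]
      · filter_upwards [hge] with t h2
        have := workDone_monotone (hx.integrable j) (hx.nonneg j) h2
        simp [hw.not_gt, (hw.trans this).not_gt]
    · have h1 : ∀ᶠ t in 𝓝[≥] T, t < r j := nhdsWithin_le_nhds (eventually_lt_nhds hr)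
      filter_upwards [h1] with t h1
      simp [h1.not_ge, hr.not_ge]
  filter_upwards [eventually_all.2 key] with t ht
  ext j
  exact ht j

open Classical in
/-- The number of releases and completions that are still to come after time `t`. -/
def pendingEvents (r p : Fin m → ℝ) (x : Fin m → ℝ → ℝ) (t : ℝ) : ℕ :=
  (Finset.univ.filter fun j => t < r j).card +
    (Finset.univ.filter fun j => workDone (x j) t < p j).card

/-- The sets of unreleased and of unfinished jobs both shrink with time. If neither lost an element,
the active set, which they determine, would be unchanged. This is the measure of progress in the
event-by-event construction. -/
theorem pendingEvents_lt {r p : Fin m → ℝ} {x : Fin m → ℝ → ℝ} (hx : Admissible x)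
    {s t : ℝ} (hst : s ≤ t) (hne : activeSet r p x t ≠ activeSet r p x s) :
    pendingEvents r p x t < pendingEvents r p x s := by
  classical
  have h1 : (Finset.univ.filter fun j => t < r j) ⊆ Finset.univ.filter fun j => s < r j := by
    intro j
    simpa using fun h => hst.trans_lt h
  have h2 : (Finset.univ.filter fun j => workDone (x j) t < p j) ⊆
      Finset.univ.filter fun j => workDone (x j) s < p j := by
    intro j
    simpa using fun h => (workDone_monotone (hx.integrable j) (hx.nonneg j) hst).trans_lt h
  unfold pendingEvents
  by_contra hlt
  have c1 := Finset.card_le_card h1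
  have c2 := Finset.card_le_card h2
  have e1 := Finset.eq_of_subset_of_card_le h1 (by omega)
  have e2 := Finset.eq_of_subset_of_card_le h2 (by omega)
  apply hne
  ext j
  have i1 := Finset.ext_iff.1 e1 j
  have i2 := Finset.ext_iff.1 e2 j
  simp only [Finset.mem_filter, Finset.mem_univ, true_and] at i1 i2
  rw [mem_activeSet, mem_activeSet, i2, ← not_lt, ← not_lt, i1]

theorem Admissible.ite {x : Fin m → ℝ → ℝ} (hx : Admissible x) {c : Fin m → ℝ}
    (hc : ∀ j, 0 ≤ c j) (T : ℝ) : Admissible fun j t => if t < T then x j t else c j := by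
  refine ⟨fun j t => ?_, fun j t => ?_⟩
  · split_ifs
    exacts [hx.nonneg j t, hc j]
  · have e : (fun u => if u < T then x j u else c j) =
        (Iio T).indicator (x j) + (Ici T).indicator fun _ => c j := by
      funext u
      by_cases h : u < T
      · simp [h]
      · simp [h, not_lt.1 h]
    have h2 : IntervalIntegrable (fun _ => c j) volume 0 t := intervalIntegrable_const
    rw [e]
    exact (intervalIntegrable_iff.2
      ((intervalIntegrable_iff.1 (hx.integrable j t)).indicator measurableSet_Iio)).add
      (intervalIntegrable_iff.2 ((intervalIntegrable_iff.1 h2).indicator measurableSet_Ici))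

/-- Rates that obey the rule `f` before time `T` extend to rates that obey it at all times. -/
theorem exists_rates_extending (r p : Fin m → ℝ) (f : Finset (Fin m) → Fin m → ℝ)
    (hf : ∀ A j, 0 ≤ f A j) (k : ℕ) : ∀ (x : Fin m → ℝ → ℝ) (T : ℝ), 0 ≤ T → Admissible x →
      (∀ t < T, ∀ j, x j t = f (activeSet r p x t) j) → pendingEvents r p x T = k →
      ∃ y : Fin m → ℝ → ℝ, Admissible y ∧ ∀ t j, y j t = f (activeSet r p y t) j := by
  induction k using Nat.strong_induction_on with
  | _ k ih =>
  intro x T hT hx hrule hk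
  set A := activeSet r p x T with hA
  -- Freeze the rates prescribed for the active set at `T`; they obey the rule until that set
  -- changes.
  let y : Fin m → ℝ → ℝ := fun j t => if t < T then x j t else f A j
  have hy : Admissible y := hx.ite (hf A) T
  have hxy : ∀ j, ∀ u < T, y j u = x j u := fun j u hu => if_pos hu
  have hact : ∀ t ≤ T, activeSet r p y t = activeSet r p x t := fun t ht =>
    activeSet_congr_of_lt hT ht hxy
  have hbefore : ∀ t < T, ∀ j, y j t = f (activeSet r p y t) j := fun t ht j => by
    rw [hxy j t ht, hrule t ht j, hact t ht.le]
  have hafter : ∀ t, T ≤ t → activeSet r p y t = A → ∀ j, y j t = f (activeSet r p y t) j :=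
    fun t ht h j => by rw [h]; exact if_neg ht.not_gt
  let B : Set ℝ := {t | T ≤ t ∧ activeSet r p y t ≠ A}
  rcases B.eq_empty_or_nonempty with hB | hB
  · refine ⟨y, hy, fun t j => ?_⟩
    rcases lt_or_ge t T with ht | ht
    · exact hbefore t ht j
    · refine hafter t ht ?_ j
      by_contra hne
      exact (hB ▸ (⟨ht, hne⟩ : t ∈ B) : t ∈ (∅ : Set ℝ))
  · have hbdd : BddBelow B := ⟨T, fun t ht => ht.1⟩
    set T' := sInf B with hT'
    have hTT' : T ≤ T' := le_csInf hB fun t ht => ht.1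
    have hbelow : ∀ t, T ≤ t → t < T' → activeSet r p y t = A := by
      intro t ht htT'
      by_contra hne
      exact (csInf_le hbdd ⟨ht, hne⟩).not_gt htT'
    -- By right-continuity the infimum is attained: the set has already changed at `T'`, so an event
    -- has been used up.
    have hne : activeSet r p y T' ≠ A := by
      intro heq
      obtain ⟨u, hu, hIco⟩ := mem_nhdsGE_iff_exists_Ico_subset.1
        (activeSet_eventually_eq r p hy T')
      obtain ⟨b, hb, hbu⟩ := exists_lt_of_csInf_lt hB (show sInf B < u from hu)
      exact hb.2 ((hIco ⟨csInf_le hbdd hb, hbu⟩ : activeSet r p y b = _).trans heq)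
    have hev : pendingEvents r p y T = pendingEvents r p x T := by
      unfold pendingEvents
      congr 3
      ext j
      rw [workDone_congr_of_lt hT le_rfl (hxy j)]
    have hlt : pendingEvents r p y T' < k := by
      rw [← hk, ← hev]
      exact pendingEvents_lt hy hTT' (by rwa [hact T le_rfl])
    refine ih _ hlt y T' (hT.trans hTT') hy (fun t ht j => ?_) rfl
    rcases lt_or_ge t T with h | h
    · exact hbefore t h j
    · exact hafter t h (hbelow t h ht) j

theorem exists_rates (r p : Fin m → ℝ) (hr : ∀ j, 0 ≤ r j) (f : Finset (Fin m) → Fin m → ℝ)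
    (hf : ∀ A j, 0 ≤ f A j) (hf0 : ∀ A, ∀ j ∉ A, f A j = 0) :
    ∃ y : Fin m → ℝ → ℝ, Admissible y ∧ ∀ t j, y j t = f (activeSet r p y t) j := by
  refine exists_rates_extending r p f hf _ (fun _ _ => 0) 0 le_rfl
    ⟨fun _ _ => le_rfl, fun _ _ => intervalIntegrable_const⟩ (fun t ht j => ?_) rfl
  refine (hf0 _ j fun hj => ?_).symm
  exact ((hr j).trans (mem_activeSet.1 hj).1).not_gt ht

/-- Continuous induction: the times at which the work done agrees form a closed set. To the right of
such a time both active sets stay constant for a while, hence so do the equal rates. -/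
theorem rates_unique {r p : Fin m → ℝ} (hr : ∀ j, 0 ≤ r j) {f : Finset (Fin m) → Fin m → ℝ}
    {x y : Fin m → ℝ → ℝ} (hx : Admissible x) (hy : Admissible y)
    (hxf : ∀ t j, x j t = f (activeSet r p x t) j)
    (hyf : ∀ t j, y j t = f (activeSet r p y t) j) : x = y := by
  let s : Set ℝ := {t | ∀ j, workDone (x j) t = workDone (y j) t}
  have hs_act : ∀ t ∈ s, activeSet r p x t = activeSet r p y t := by
    intro t ht
    ext j
    rw [mem_activeSet, mem_activeSet, ht j]
  have hneg : ∀ z : Fin m → ℝ → ℝ, ∀ t < 0, activeSet r p z t = ∅ := by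
    intro z t ht
    refine Finset.eq_empty_of_forall_notMem fun j hj => ?_
    exact ((hr j).trans (mem_activeSet.1 hj).1).not_gt ht
  have hclosed : IsClosed s := by
    have : s = ⋂ j, {t | workDone (x j) t = workDone (y j) t} := by
      ext t
      simp [s]
    rw [this]
    exact isClosed_iInter fun j => isClosed_eq (workDone_continuous (hx.integrable j))
      (workDone_continuous (hy.integrable j))
  have hs : ∀ t, 0 ≤ t → t ∈ s := by
    intro t ht
    refine (hclosed.inter isClosed_Icc).Icc_subset_of_forall_mem_nhdsWithin (a := 0) (b := t)
      (fun j => by simp [workDone]) ?_ ⟨ht, le_rfl⟩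
    rintro u ⟨hu, -⟩
    have hev := (activeSet_eventually_eq r p hx u).and (activeSet_eventually_eq r p hy u)
    obtain ⟨v, hv, hIco⟩ := mem_nhdsGE_iff_exists_Ico_subset.1 hev
    refine mem_of_superset (Ioo_mem_nhdsGT (show u < v from hv)) fun w hw j => ?_
    rw [workDone_add_integral (hx.integrable j) u w, workDone_add_integral (hy.integrable j) u w,
      hu j]
    congr 1
    refine intervalIntegral.integral_congr fun a ha => ?_
    rw [uIcc_of_le hw.1.le] at ha
    have h := hIco ⟨ha.1, ha.2.trans_lt hw.2⟩
    simp only [mem_ofPred_eq] at h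
    rw [hxf, hyf, h.1, h.2, hs_act u hu]
  funext j t
  rw [hxf, hyf]
  rcases lt_or_ge t 0 with ht | ht
  · rw [hneg x t ht, hneg y t ht]
  · rw [hs_act t (hs t ht)]

end Dynamics

/-! ### The order of lateness and the latest jobs of a set -/

section Latest

variable {m : ℕ} {r : Fin m → ℝ}

theorem Later.irrefl (j : Fin m) : ¬ Later r j j := by
  simp [Later]

theorem Later.trans {i j k : Fin m} (h₁ : Later r i j) (h₂ : Later r j k) : Later r i k := by
  unfold Later at *
  rcases h₁ with h₁ | h₁ <;> rcases h₂ with h₂ | h₂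
  · exact Or.inl (h₂.trans h₁)
  · exact Or.inl (h₂.1.trans_lt h₁)
  · exact Or.inl (h₂.trans_eq h₁.1)
  · exact Or.inr ⟨h₂.1.trans h₁.1, h₂.2.trans h₁.2⟩

theorem Later.trichotomous (i j : Fin m) : Later r i j ∨ i = j ∨ Later r j i := by
  unfold Later
  rcases lt_trichotomy (r i) (r j) with h | h | h
  · exact Or.inr (Or.inr (Or.inl h))
  · rcases lt_trichotomy i j with h' | h' | h'
    · exact Or.inr (Or.inr (Or.inr ⟨h, h'⟩))
    · exact Or.inr (Or.inl h')
    · exact Or.inl (Or.inr ⟨h.symm, h'⟩)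
  · exact Or.inl (Or.inl h)

open Classical in
theorem card_later_lt {A : Finset (Fin m)} {i j : Fin m} (hi : i ∈ A) (h : Later r i j) :
    (A.filter fun l => Later r l i).card < (A.filter fun l => Later r l j).card := by
  apply Finset.card_lt_card
  refine ⟨fun l hl => ?_, fun hsub => ?_⟩
  · rw [Finset.mem_filter] at hl ⊢
    exact ⟨hl.1, hl.2.trans h⟩
  · exact Later.irrefl i (Finset.mem_filter.1 (hsub (Finset.mem_filter.2 ⟨hi, h⟩))).2

theorem latest_subset (r : Fin m → ℝ) (A : Finset (Fin m)) (k : ℕ) : latest r A k ⊆ A :=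
  Finset.filter_subset _ _

/-- Lateness is a strict total order, so counting later jobs maps `A` bijectively onto `0, …, |A| -
1`. -/
theorem card_latest {A : Finset (Fin m)} {k : ℕ} (hk : k ≤ A.card) :
    (latest r A k).card = k := by
  classical
  let c : Fin m → ℕ := fun j => (A.filter fun i => Later r i j).card
  have hinj : Set.InjOn c A := by
    intro i hi j hj hij
    rcases Later.trichotomous (r := r) i j with h | h | h
    · exact absurd hij (card_later_lt hi h).ne
    · exact h
    · exact absurd hij (card_later_lt hj h).ne'
  have hlt : ∀ j ∈ A, c j < A.card := fun j hj => by
    refine Finset.card_lt_card ⟨Finset.filter_subset _ _, fun hsub => ?_⟩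
    exact Later.irrefl j (Finset.mem_filter.1 (hsub hj)).2
  have himage : A.image c = Finset.range A.card := by
    refine Finset.eq_of_subset_of_card_le (fun i hi => ?_) ?_
    · obtain ⟨j, hj, rfl⟩ := Finset.mem_image.1 hi
      exact Finset.mem_range.2 (hlt j hj)
    · rw [Finset.card_range, Finset.card_image_of_injOn hinj]
  have hL : (latest r A k).image c = Finset.range k := by
    ext i
    simp only [Finset.mem_image, Finset.mem_range, latest, Finset.mem_filter]
    constructor
    · rintro ⟨j, hj, rfl⟩
      exact hj.2
    · intro hi
      have : i ∈ A.image c := himage ▸ Finset.mem_range.2 (hi.trans_le hk)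
      obtain ⟨j, hj, rfl⟩ := Finset.mem_image.1 this
      exact ⟨j, ⟨hj, hi⟩, rfl⟩
  rw [← Finset.card_image_of_injOn (hinj.mono (Finset.coe_subset.2 (latest_subset r A k))), hL,
    Finset.card_range]

end Latest

/-! ### LAPS as a function of the active set -/

section Rule

variable {I : JobSequence}

theorem Schedule.admissible (S : Schedule I) : Admissible S.rate :=
  ⟨S.rate_nonneg, S.rate_integrable⟩

theorem Schedule.active_eq (S : Schedule I) (t : ℝ) :
    S.active t = activeSet I.release I.work S.rate t := by
  ext j
  simp [Schedule.active, Schedule.CompletedBy, mem_activeSet]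

theorem Schedule.mem_active {S : Schedule I} {t : ℝ} {j : Fin I.size} :
    j ∈ S.active t ↔ I.release j ≤ t ∧ workDone (S.rate j) t < I.work j := by
  rw [S.active_eq, mem_activeSet]

open Classical in
/-- The rate at which LAPS(δ, β) processes job `j` when the set of active jobs is `A`. -/
def lapsRate (α δ β : ℝ) (I : JobSequence) (A : Finset (Fin I.size)) (j : Fin I.size) : ℝ :=
  if j ∈ latest I.release A ⌈β * (A.card : ℝ)⌉₊ then
    (1 + δ) * (A.card : ℝ) ^ (1 / α) / (⌈β * (A.card : ℝ)⌉₊ : ℝ) else 0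

theorem lapsRate_nonneg {α δ β : ℝ} (hδ : 0 ≤ δ) (A : Finset (Fin I.size)) (j : Fin I.size) :
    0 ≤ lapsRate α δ β I A j := by
  unfold lapsRate
  split_ifs <;> positivity

theorem lapsRate_eq_zero {α δ β : ℝ} {A : Finset (Fin I.size)} {j : Fin I.size} (hj : j ∉ A) :
    lapsRate α δ β I A j = 0 :=
  if_neg fun h => hj (latest_subset _ _ _ h)

theorem ceil_mul_card_le {β : ℝ} (hβ : β ≤ 1) (n : ℕ) : ⌈β * (n : ℝ)⌉₊ ≤ n :=
  Nat.ceil_le.2 (mul_le_of_le_one_left n.cast_nonneg hβ)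

theorem sum_lapsRate {α δ β : ℝ} (hα : 0 < α) (hβ0 : 0 < β) (hβ1 : β ≤ 1)
    (A : Finset (Fin I.size)) :
    ∑ j, lapsRate α δ β I A j = (1 + δ) * (A.card : ℝ) ^ (1 / α) := by
  classical
  simp only [lapsRate, Finset.sum_ite_mem, Finset.univ_inter, Finset.sum_const,
    card_latest (ceil_mul_card_le hβ1 _), nsmul_eq_mul]
  rcases Nat.eq_zero_or_pos A.card with h | h
  · simp [h, Real.zero_rpow (inv_ne_zero hα.ne')]
  · have : 0 < ⌈β * (A.card : ℝ)⌉₊ := Nat.ceil_pos.2 (by positivity)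
    field_simp

theorem followsLAPS_iff {α δ β : ℝ} (hα : 0 < α) (hβ0 : 0 < β) (hβ1 : β ≤ 1) (S : Schedule I) :
    FollowsLAPS α δ β S ↔ ∀ t j, S.rate j t = lapsRate α δ β I (S.active t) j := by
  constructor
  · intro h t j
    unfold lapsRate
    split_ifs with hj
    · rw [h.rate_eq_of_mem t j hj, h.speed_eq]
    · exact h.rate_eq_of_notMem t j hj
  · intro h
    have hs : ∀ t, S.speed t = (1 + δ) * ((S.active t).card : ℝ) ^ (1 / α) := fun t => by
      rw [Schedule.speed, ← sum_lapsRate hα hβ0 hβ1]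
      exact Finset.sum_congr rfl fun j _ => h t j
    refine ⟨hs, fun t j hj => ?_, fun t j hj => ?_⟩
    · rw [h t j, hs t]
      exact if_pos hj
    · rw [h t j]
      exact if_neg hj

theorem existsUnique_followsLAPS {α δ β : ℝ} (hα : 0 < α) (hδ : 0 ≤ δ) (hβ0 : 0 < β)
    (hβ1 : β ≤ 1) (I : JobSequence) : ∃! S : Schedule I, FollowsLAPS α δ β S := by
  obtain ⟨x, hx, hxf⟩ := exists_rates I.release I.work I.release_nonneg (lapsRate α δ β I)
    (lapsRate_nonneg hδ) fun A j hj => lapsRate_eq_zero hj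
  let S : Schedule I :=
    { rate := x
      rate_nonneg := hx.nonneg
      rate_integrable := hx.integrable
      rate_eq_zero := fun j t h => by
        rw [hxf]
        exact lapsRate_eq_zero fun hj => h (mem_activeSet.1 hj) }
  refine ⟨S, (followsLAPS_iff hα hβ0 hβ1 S).2 fun t j => ?_, fun S' hS' => ?_⟩
  · rw [S.active_eq]
    exact hxf t j
  · replace hS' := (followsLAPS_iff hα hβ0 hβ1 S').1 hS'
    refine Schedule.ext (rates_unique I.release_nonneg S'.admissible hx (fun t j => ?_) hxf)
    rw [← S'.active_eq]
    exact hS' t j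

end Rule

/-! ### Total flow time as the integral of the number of active jobs -/

section Flow

variable {I : JobSequence}

theorem Schedule.workDone_rate_continuous (S : Schedule I) (j : Fin I.size) :
    Continuous (workDone (S.rate j)) :=
  workDone_continuous (S.rate_integrable j)

theorem Schedule.workDone_rate_monotone (S : Schedule I) (j : Fin I.size) :
    Monotone (workDone (S.rate j)) :=
  workDone_monotone (S.rate_integrable j) (S.rate_nonneg j)

theorem workDone_zero (g : ℝ → ℝ) : workDone g 0 = 0 :=
  intervalIntegral.integral_same

/-- Once the work done reaches the requirement the rate vanishes, so it cannot overshoot. -/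
theorem Schedule.workDone_le_work (S : Schedule I) (j : Fin I.size) (t : ℝ) :
    workDone (S.rate j) t ≤ I.work j := by
  by_contra! h
  have ht : 0 ≤ t := by
    by_contra! ht
    have := S.workDone_rate_monotone j ht.le
    rw [workDone_zero] at this
    linarith [I.work_pos j]
  obtain ⟨s, hs, hsW⟩ := intermediate_value_Icc ht (S.workDone_rate_continuous j).continuousOn
    ⟨by rw [workDone_zero]; exact (I.work_pos j).le, h.le⟩
  have hzero : ∫ u in s..t, S.rate j u = 0 := by
    refine intervalIntegral.integral_zero_ae (ae_of_all _ fun u hu => ?_)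
    rw [uIoc_of_le hs.2] at hu
    refine S.rate_eq_zero j u fun hact => ?_
    have := S.workDone_rate_monotone j hu.1.le
    rw [hsW] at this
    exact this.not_gt hact.2
  rw [workDone_add_integral (S.rate_integrable j) s t, hsW, hzero, add_zero] at h
  exact lt_irrefl _ h

theorem Schedule.measurableSet_active (S : Schedule I) (j : Fin I.size) :
    MeasurableSet {t | j ∈ S.active t} := by
  simp only [Schedule.mem_active]
  exact measurableSet_Ici.inter
    ((isOpen_lt (S.workDone_rate_continuous j) continuous_const).measurableSet)

/-- A job is active on an interval that starts at its release and is cut off by completion. Both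
sides are infinite if it never completes. -/
theorem Schedule.flowTime_eq_volume (S : Schedule I) (j : Fin I.size) :
    S.flowTime j = volume {t | j ∈ S.active t} := by
  apply le_antisymm
  · refine ENNReal.le_of_forall_nnreal_lt fun s hs => ?_
    have hsub : Ico (I.release j) (I.release j + s) ⊆ {t | j ∈ S.active t} := by
      intro t ht
      rw [mem_ofPred_eq, Schedule.mem_active]
      refine ⟨ht.1, ?_⟩
      by_contra! hc
      have h1 : S.flowTime j ≤ ENNReal.ofReal (t - I.release j) := iInf₂_le t ⟨ht.1, hc⟩
      have h2 : ENNReal.ofReal (t - I.release j) ≤ s := by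
        rw [← ENNReal.ofReal_coe_nnreal]
        exact ENNReal.ofReal_le_ofReal (by linarith [ht.2])
      exact (hs.trans_le (h1.trans h2)).false
    calc (s : ℝ≥0∞) = volume (Ico (I.release j) (I.release j + s)) := by simp
      _ ≤ _ := measure_mono hsub
  · refine le_iInf₂ fun t ht => ?_
    have hsub : {u | j ∈ S.active u} ⊆ Ico (I.release j) t := by
      intro u hu
      rw [mem_ofPred_eq, Schedule.mem_active] at hu
      refine ⟨hu.1, ?_⟩
      by_contra! htu
      exact ((ht.2.trans (S.workDone_rate_monotone j htu)).trans_lt hu.2).false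
    exact (measure_mono hsub).trans (by simp)

theorem card_filter_active_eq (S : Schedule I) (P : Fin I.size → Prop) [DecidablePred P] (t : ℝ) :
    ((S.active t).filter P).card = ∑ j, if j ∈ S.active t ∧ P j then 1 else 0 := by
  rw [← Finset.card_filter]
  congr 1
  ext j
  simp

theorem measurable_card_filter_active (S : Schedule I) (P : Fin I.size → Prop)
    [DecidablePred P] :
    Measurable fun t => ((S.active t).filter P).card := by
  simp only [card_filter_active_eq]
  refine Finset.measurable_sum _ fun j _ => Measurable.ite ?_ measurable_const measurable_const
  exact (S.measurableSet_active j).inter (MeasurableSet.const (P j))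

theorem measurable_card_active (S : Schedule I) : Measurable fun t => (S.active t).card := by
  classical
  simpa using measurable_card_filter_active S fun _ => True

theorem Schedule.totalFlow_eq_lintegral (S : Schedule I) :
    S.totalFlow = ∫⁻ t in Ici (0 : ℝ), ENNReal.ofReal ((S.active t).card : ℝ) := by
  classical
  have hcard : ∀ t, ENNReal.ofReal ((S.active t).card : ℝ) =
      ∑ j, {t | j ∈ S.active t}.indicator (fun _ => (1 : ℝ≥0∞)) t := by
    intro t
    rw [ENNReal.ofReal_natCast]
    simp [indicator]
  simp only [hcard]
  rw [lintegral_finsetSum _ fun j _ => measurable_const.indicator (S.measurableSet_active j)]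
  refine Finset.sum_congr rfl fun j _ => ?_
  rw [S.flowTime_eq_volume, lintegral_indicator (S.measurableSet_active j), setLIntegral_one,
    Measure.restrict_apply (S.measurableSet_active j), inter_eq_left.2]
  intro t ht
  rw [mem_ofPred_eq, Schedule.mem_active] at ht
  exact (I.release_nonneg j).trans ht.1

end Flow

/-! ### The growth of the positive part of a primitive -/

section PositivePart

theorem _root_.AbsolutelyContinuousOnInterval.max_zero {f : ℝ → ℝ} {a b : ℝ}
    (hf : AbsolutelyContinuousOnInterval f a b) :
    AbsolutelyContinuousOnInterval (fun t => max (f t) 0) a b := by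
  rw [absolutelyContinuousOnInterval_iff] at hf ⊢
  intro ε hε
  obtain ⟨δ, hδ, h⟩ := hf ε hε
  refine ⟨δ, hδ, fun E hE hlen => (Finset.sum_le_sum fun i _ => ?_).trans_lt (h E hE hlen)⟩
  rw [Real.dist_eq, Real.dist_eq]
  exact abs_max_sub_max_le_abs _ _ _

/-- A primitive increases by its final positive part while it is positive. -/
theorem integral_indicator_pos_eq {g : ℝ → ℝ} (hg : ∀ t, IntervalIntegrable g volume 0 t)
    (T : ℝ) :
    ∫ u in (0 : ℝ)..T, {u | 0 < workDone g u}.indicator g u = max (workDone g T) 0 := by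
  have hac : AbsolutelyContinuousOnInterval (fun t => max (workDone g t) 0) 0 T :=
    ((hg T).absolutelyContinuousOnInterval_intervalIntegral left_mem_uIcc).max_zero
  have h := hac.integral_deriv_eq_sub
  rw [workDone_zero, max_self, sub_zero] at h
  rw [← h]
  apply intervalIntegral.integral_congr_ae
  have hc := workDone_continuous hg
  filter_upwards [(hg T).ae_hasDerivAt_integral] with u hderiv hu
  have huI : u ∈ uIcc 0 T := uIoc_subset_uIcc hu
  have hder : HasDerivAt (workDone g) (g u) u := hderiv huI 0 left_mem_uIcc
  rcases lt_trichotomy (workDone g u) 0 with hneg | hzero | hpos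
  · have he : (fun t => max (workDone g t) 0) =ᶠ[𝓝 u] fun _ => 0 := by
      filter_upwards [hc.continuousAt.eventually_lt continuousAt_const hneg] with t ht
      exact max_eq_right ht.le
    rw [he.deriv_eq, deriv_const, indicator_of_notMem (by simpa using hneg.le)]
  -- At a zero the positive part has a local minimum, so its `deriv` is 0 whatever the value of `g`.
  · have hmin : IsLocalMin (fun t => max (workDone g t) 0) u :=
      Eventually.of_forall fun t => by simp [hzero]
    rw [hmin.deriv_eq_zero, indicator_of_notMem (by simpa using hzero.le)]
  · have he : (fun t => max (workDone g t) 0) =ᶠ[𝓝 u] workDone g := by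
      filter_upwards [continuousAt_const.eventually_lt hc.continuousAt hpos] with t ht
      exact max_eq_left ht.le
    rw [he.deriv_eq, hder.deriv, indicator_of_mem (show u ∈ {u | 0 < workDone g u} from hpos)]

end PositivePart

/-! ### Nonincreasing weights against nonnegative primitives -/

section AntitoneWeights

variable {h : ℝ → ℝ} {b ρ : ℝ}

/-- Beyond `ρ` the set `D` is an initial segment, and before `ρ` the integrand vanishes, so the
integral is a partial integral of `h`. -/
theorem integral_indicator_nonneg_of_downClosed (hb : 0 ≤ b)
    (hint : IntervalIntegrable h volume 0 b) (hρ : ∀ u < ρ, h u = 0)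
    (hprim : ∀ T ∈ Icc 0 b, 0 ≤ ∫ u in (0 : ℝ)..T, h u) {D : Set ℝ} (hD : MeasurableSet D)
    (hdown : ∀ u v, ρ ≤ u → u ≤ v → v ∈ D → u ∈ D) :
    0 ≤ ∫ u in (0 : ℝ)..b, D.indicator h u := by
  let E : Set ℝ := {u | 0 ≤ u ∧ u ≤ b ∧ (u < ρ ∨ u ∈ D)}
  set T := sSup (insert 0 E) with hTdef
  have hbdd : BddAbove (insert 0 E) :=
    ⟨b, by rintro u (rfl | hu); exacts [hb, hu.2.1]⟩
  have hT0 : 0 ≤ T := le_csSup hbdd (mem_insert _ _)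
  have hTb : T ≤ b := csSup_le ⟨0, mem_insert _ _⟩
    (by rintro u (rfl | hu); exacts [hb, hu.2.1])
  have hbelow : ∀ u, 0 ≤ u → u < T → u < ρ ∨ u ∈ D := by
    intro u hu huT
    obtain ⟨v, hv, huv⟩ := exists_lt_of_lt_csSup ⟨0, mem_insert _ _⟩ huT
    rcases hv with rfl | hv
    · exact absurd hu huv.not_ge
    · rcases lt_or_ge u ρ with h1 | h1
      · exact Or.inl h1
      · rcases hv.2.2 with h2 | h2
        · exact absurd (huv.trans h2) h1.not_gt
        · exact Or.inr (hdown u v h1 huv.le h2)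
  have habove : ∀ u, T < u → u ≤ b → u ∉ D := fun u hu hub huD =>
    (le_csSup hbdd (mem_insert_of_mem _ ⟨hT0.trans hu.le, hub, Or.inr huD⟩)).not_gt hu
  have hint' : IntervalIntegrable (D.indicator h) volume 0 b :=
    intervalIntegrable_iff.2 ((intervalIntegrable_iff.1 hint).indicator hD)
  have hTmem : T ∈ uIcc 0 b := by
    rw [uIcc_of_le hb]
    exact ⟨hT0, hTb⟩
  rw [← intervalIntegral.integral_add_adjacent_intervals
    (hint'.mono_set (uIcc_subset_uIcc left_mem_uIcc hTmem))
    (hint'.mono_set (uIcc_subset_uIcc hTmem right_mem_uIcc))]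
  have hsecond : ∫ u in T..b, D.indicator h u = 0 := by
    refine intervalIntegral.integral_zero_ae (ae_of_all _ fun u hu => ?_)
    rw [uIoc_of_le hTb] at hu
    exact indicator_of_notMem (habove u hu.1 hu.2) _
  have hfirst : ∫ u in (0 : ℝ)..T, D.indicator h u = ∫ u in (0 : ℝ)..T, h u := by
    apply intervalIntegral.integral_congr_ae
    have hne : ∀ᵐ u : ℝ, u ≠ T := by simp [ae_iff]
    filter_upwards [hne] with u hu hmem
    rw [uIoc_of_le hT0] at hmem
    by_cases huD : u ∈ D
    · exact indicator_of_mem huD _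
    · rcases hbelow u hmem.1.le (lt_of_le_of_ne hmem.2 hu) with h1 | h1
      · rw [indicator_of_notMem huD, hρ u h1]
      · exact absurd h1 huD
  rw [hsecond, hfirst, add_zero]
  exact hprim T ⟨hT0, hTb⟩

theorem eq_add_sum_increments (F : ℕ → ℝ) {n M : ℕ} (hn : n ≤ M) :
    F n = F 0 + ∑ i ∈ Finset.range M, if i < n then F (i + 1) - F i else 0 := by
  rw [← Finset.sum_filter]
  have : (Finset.range M).filter (fun i => i < n) = Finset.range n := by
    ext i
    simp only [Finset.mem_filter, Finset.mem_range]
    omega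
  rw [this, Finset.sum_range_sub]
  ring

/-- A nonnegative nonincreasing weight preserves the nonnegativity of the integral of a function
all of whose partial integrals are nonnegative. -/
theorem integral_weight_mul_nonneg (hb : 0 ≤ b) (hint : IntervalIntegrable h volume 0 b)
    (hρ : ∀ u < ρ, h u = 0) (hprim : ∀ T ∈ Icc 0 b, 0 ≤ ∫ u in (0 : ℝ)..T, h u)
    {F : ℕ → ℝ} (hF : Monotone F) (hF0 : 0 ≤ F 0) {N : ℝ → ℕ} (hN : Measurable N) {M : ℕ}
    (hNM : ∀ u, N u ≤ M) (hanti : AntitoneOn N (Ici ρ)) :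
    0 ≤ ∫ u in (0 : ℝ)..b, F (N u) * h u := by
  have hmeas : ∀ i, MeasurableSet {u | i < N u} := fun i => hN (measurableSet_Ioi (a := i))
  -- Layer-cake decomposition: the weight is a nonnegative combination of 1 and the indicators of
  -- `{i < N}`, each down-closed beyond `ρ`.
  have hrepr : ∀ u, F (N u) * h u = F 0 * h u +
      ∑ i ∈ Finset.range M, (F (i + 1) - F i) * {u | i < N u}.indicator h u := by
    intro u
    rw [eq_add_sum_increments F (hNM u), add_mul, Finset.sum_mul]
    congr 1
    refine Finset.sum_congr rfl fun i _ => ?_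
    by_cases hi : i < N u
    · simp [indicator, hi]
    · simp [indicator, hi]
  have hint' : ∀ i, IntervalIntegrable (fun u => (F (i + 1) - F i) *
      {u | i < N u}.indicator h u) volume 0 b := fun i =>
    (intervalIntegrable_iff.2
      ((intervalIntegrable_iff.1 hint).indicator (hmeas i))).const_mul _
  have hsum : IntervalIntegrable (fun u => ∑ i ∈ Finset.range M, (F (i + 1) - F i) *
      {u | i < N u}.indicator h u) volume 0 b := by
    simpa only [Finset.sum_fn] using IntervalIntegrable.sum (Finset.range M) fun i _ => hint' i
  simp only [hrepr]
  rw [intervalIntegral.integral_add (hint.const_mul _) hsum,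
    intervalIntegral.integral_finsetSum fun i _ => hint' i,
    intervalIntegral.integral_const_mul]
  refine add_nonneg (mul_nonneg hF0 (hprim b ⟨hb, le_rfl⟩)) (Finset.sum_nonneg fun i _ => ?_)
  rw [intervalIntegral.integral_const_mul]
  refine mul_nonneg (sub_nonneg.2 (hF i.le_succ)) ?_
  refine integral_indicator_nonneg_of_downClosed hb hint hρ hprim (hmeas i) ?_
  intro u v hu huv hv
  exact lt_of_lt_of_le (show i < N v from hv) (hanti hu (hu.trans huv) huv)

end AntitoneWeights

/-! ### The pointwise drift inequality -/

section Amortization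

open Classical in
/-- The rank of job `j` relative to the set `A`: the number of jobs of `A` that are not later
than `j`. -/
def jobRank {m : ℕ} (r : Fin m → ℝ) (A : Finset (Fin m)) (j : Fin m) : ℕ :=
  (A.filter fun i => ¬ Later r i j).card

theorem jobRank_le_card {m : ℕ} (r : Fin m → ℝ) (A : Finset (Fin m)) (j : Fin m) :
    jobRank r A j ≤ A.card := by
  classical
  exact Finset.card_filter_le _ _

/-- Fewer than `k` jobs are later than `j`, so all the others count towards its rank, which is
therefore at least `|A| - k + 1`. -/
theorem card_lt_jobRank_add {m : ℕ} {r : Fin m → ℝ} {A : Finset (Fin m)} {k : ℕ} {j : Fin m}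
    (hj : j ∈ latest r A k) : A.card < jobRank r A j + k := by
  classical
  have h1 := (Finset.mem_filter.1 hj).2
  have h2 := Finset.card_filter_add_card_filter_not (s := A) fun i => Later r i j
  unfold jobRank
  omega

theorem mul_rpow_le_young {α s n : ℝ} (hα : 1 < α) (hs : 0 ≤ s) (hn : 0 ≤ n) :
    n ^ (1 - 1 / α) * s ≤ s ^ α / α + (1 - 1 / α) * n := by
  have hα0 : 0 < α := by linarith
  have h1 : 1 / α ≤ 1 := by rw [div_le_one hα0]; exact hα.le
  have h := Real.geom_mean_le_arith_mean2_weighted (w₁ := 1 / α) (w₂ := 1 - 1 / α)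
    (by positivity) (by linarith) (Real.rpow_nonneg hs α) hn (by ring)
  rw [← Real.rpow_mul hs, mul_one_div_cancel hα0.ne', Real.rpow_one] at h
  calc _ = s * n ^ (1 - 1 / α) := mul_comm _ _
    _ ≤ _ := h
    _ = _ := by ring

/-- The drift inequality. Here `A` and `O` are the jobs active under LAPS(3/α, 1/(2α)) and under a
competing schedule, `X` the jobs on which LAPS lags behind, and `o` the competitor's rates. -/
theorem sum_rank_mul_sub_le {I : JobSequence} {α : ℝ} (hα : 1 < α) {A O X : Finset (Fin I.size)}
    (hXA : X ⊆ A) (hXO : ∀ j ∈ A, j ∉ X → j ∈ O) {o : Fin I.size → ℝ} (ho : ∀ j, 0 ≤ o j) :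
    ∑ j ∈ X, (jobRank I.release A j : ℝ) ^ (1 - 1 / α) *
        (o j - lapsRate α (3 / α) (1 / (2 * α)) I A j) ≤
      (∑ j, o j) ^ α / α - 2 / α * A.card + (2 * α + 6) * O.card := by
  classical
  have hα0 : 0 < α := by linarith
  have hs : 0 ≤ ∑ j, o j := Finset.sum_nonneg fun j _ => ho j
  rcases Finset.eq_empty_or_nonempty A with rfl | hA
  · rw [Finset.subset_empty.1 hXA]
    simp only [Finset.sum_empty, Finset.card_empty, Nat.cast_zero, mul_zero, sub_zero]
    positivity
  set n : ℝ := (A.card : ℝ) with hn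
  have hn0 : 0 < n := Nat.cast_pos.2 hA.card_pos
  set β : ℝ := 1 / (2 * α) with hβ
  set δ : ℝ := 3 / α with hδ
  set e : ℝ := 1 - 1 / α with he
  have hi0 : 0 < 1 / α := by positivity
  have hi1 : 1 / α < 1 := by rw [div_lt_one hα0]; exact hα
  have hβi : β = 1 / α / 2 := by rw [hβ]; field_simp
  have hδi : δ = 3 * (1 / α) := by rw [hδ]; ring
  have he0 : 0 ≤ e := by linarith
  have he1 : e ≤ 1 := by linarith
  have hβ0 : 0 < β := by positivity
  have hβ1 : β < 1 := by linarith
  set k : ℕ := ⌈β * n⌉₊ with hk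
  have hk0 : (0 : ℝ) < k := by exact_mod_cast Nat.ceil_pos.2 (by positivity)
  have hkge : β * n ≤ k := Nat.le_ceil _
  have hklt : (k : ℝ) < β * n + 1 := Nat.ceil_lt_add_one (by positivity)
  have hkn : k ≤ A.card := ceil_mul_card_le hβ1.le _
  set L := latest I.release A k with hL
  set σ : ℝ := (1 + δ) * n ^ (1 / α) with hσ
  have hσ0 : 0 ≤ σ := by positivity
  set w : ℝ := ((1 - β) * n) ^ e with hw
  have hw0 : 0 ≤ w := Real.rpow_nonneg (mul_nonneg (by linarith) hn0.le) _
  have hrate : ∀ j ∈ L, lapsRate α δ β I A j = σ / k := fun j hj => if_pos hj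
  have hrate0 : ∀ j, 0 ≤ lapsRate α δ β I A j := lapsRate_nonneg (by positivity) A
  have hwσ : w * σ = (1 + δ) * (1 - β) ^ e * n := by
    rw [hw, hσ, Real.mul_rpow (by linarith) hn0.le]
    have : n ^ e * n ^ (1 / α) = n := by
      rw [← Real.rpow_add hn0, he, sub_add_cancel, Real.rpow_one]
    calc _ = (1 + δ) * (1 - β) ^ e * (n ^ e * n ^ (1 / α)) := by ring
      _ = _ := by rw [this]
  have hβe1 : (1 - β) ^ e ≤ 1 := Real.rpow_le_one (by linarith) (by linarith) he0
  have hβe2 : 1 - β ≤ (1 - β) ^ e := by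
    simpa using Real.rpow_le_rpow_of_exponent_ge (by linarith : 0 < 1 - β) (by linarith) he1
  -- With `i = 1/α < 1`, `(1 + 3i)(1 - i/2) = 1 + i + 3i(1 - i)/2 ≥ 1 + i`. Against the `(1 - i) n`
  -- from Young's inequality this leaves `-2i n`.
  have hlower : (1 + 1 / α) * n ≤ w * σ := by
    rw [hwσ]
    gcongr
    calc 1 + 1 / α ≤ (1 + δ) * (1 - β) := by rw [hδi, hβi]; nlinarith
      _ ≤ (1 + δ) * (1 - β) ^ e := by gcongr
  -- The price of one processed job that does not lag: at most `(1 + δ)/β = 2α + 6`.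
  have hupper : w * σ / k ≤ 2 * α + 6 := by
    rw [div_le_iff₀ hk0, hwσ]
    calc (1 + δ) * (1 - β) ^ e * n ≤ (1 + δ) * 1 * n := by gcongr
      _ = (2 * α + 6) * (β * n) := by rw [hδ, hβ]; field_simp; ring
      _ ≤ (2 * α + 6) * k := by gcongr
  have hopt : ∑ j ∈ X, (jobRank I.release A j : ℝ) ^ e * o j ≤
      (∑ j, o j) ^ α / α + (1 - 1 / α) * n := by
    calc _ ≤ ∑ j ∈ X, n ^ e * o j := Finset.sum_le_sum fun j _ => by
          gcongr
          · exact ho j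
          · exact Nat.cast_le.2 (jobRank_le_card _ _ _)
      _ ≤ ∑ j, n ^ e * o j := Finset.sum_le_sum_of_subset_of_nonneg (Finset.subset_univ _)
          fun j _ _ => mul_nonneg (Real.rpow_nonneg hn0.le _) (ho j)
      _ = n ^ e * ∑ j, o j := by rw [Finset.mul_sum]
      _ ≤ _ := mul_rpow_le_young hα hs hn0.le
  -- A processed job that does not lag is still active for the competitor, so there are at most
  -- `O.card` of these.
  have hcard : (k : ℝ) - O.card ≤ (L ∩ X).card := by
    have h1 : (L \ X).card ≤ O.card := Finset.card_le_card fun j hj => by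
      rw [Finset.mem_sdiff] at hj
      exact hXO j (latest_subset _ _ _ hj.1) hj.2
    have h2 := Finset.card_inter_add_card_sdiff L X
    rw [hL, card_latest hkn, ← hL] at h2
    have : k ≤ (L ∩ X).card + O.card := by omega
    have : (k : ℝ) ≤ (L ∩ X).card + O.card := by exact_mod_cast this
    linarith
  have hlaps : w * σ - (2 * α + 6) * O.card ≤
      ∑ j ∈ X, (jobRank I.release A j : ℝ) ^ e * lapsRate α δ β I A j := by
    calc w * σ - (2 * α + 6) * O.card ≤ w * σ - w * σ / k * O.card := by gcongr
      _ = (k - O.card) * (w * (σ / k)) := by field_simp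
      _ ≤ (L ∩ X).card * (w * (σ / k)) := by gcongr
      _ = ∑ j ∈ L ∩ X, w * (σ / k) := by rw [Finset.sum_const, nsmul_eq_mul]
      _ ≤ ∑ j ∈ L ∩ X, (jobRank I.release A j : ℝ) ^ e * lapsRate α δ β I A j := by
          refine Finset.sum_le_sum fun j hj => ?_
          have hjL := (Finset.mem_inter.1 hj).1
          rw [hrate j hjL]
          have h1 : A.card + 1 ≤ jobRank I.release A j + k := card_lt_jobRank_add hjL
          have h2 : n + 1 ≤ jobRank I.release A j + k := by
            rw [hn]
            exact_mod_cast h1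
          -- The `+ 1` in the rank bound absorbs the rounding in `k < β n + 1`.
          have h3 : (1 - β) * n ≤ jobRank I.release A j := by linarith
          have h4 : 0 ≤ (1 - β) * n := mul_nonneg (by linarith) hn0.le
          gcongr
          exact Real.rpow_le_rpow h4 h3 he0
      _ ≤ _ := Finset.sum_le_sum_of_subset_of_nonneg Finset.inter_subset_right
          fun j _ _ => mul_nonneg (Real.rpow_nonneg (Nat.cast_nonneg _) _) (hrate0 j)
  simp only [mul_sub, Finset.sum_sub_distrib]
  have h2 : 2 / α * n = 2 * (1 / α) * n := by ring
  rw [h2]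
  linarith

end Amortization

/-! ### Integration over time and the competitive ratio -/

section Competitive

variable {I : JobSequence}

theorem measurable_jobRank_active (S : Schedule I) (j : Fin I.size) :
    Measurable fun t => jobRank I.release (S.active t) j := by
  classical
  exact measurable_card_filter_active S _

/-- Every job that is not later than `j` has been released by `I.release j`, so from then on the
counted set only loses jobs to completion. -/
theorem antitoneOn_jobRank_active (S : Schedule I) (j : Fin I.size) :
    AntitoneOn (fun t => jobRank I.release (S.active t) j) (Ici (I.release j)) := by
  classical
  intro s hs t _ hst
  refine Finset.card_le_card fun i hi => ?_
  rw [Finset.mem_filter, Schedule.mem_active] at hi ⊢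
  refine ⟨⟨?_, (S.workDone_rate_monotone i hst).trans_lt hi.1.2⟩, hi.2⟩
  have : I.release i ≤ I.release j := not_lt.1 fun h => hi.2 (Or.inl h)
  exact this.trans hs

theorem workDone_sub {g h : ℝ → ℝ} (hg : ∀ t, IntervalIntegrable g volume 0 t)
    (hh : ∀ t, IntervalIntegrable h volume 0 t) (t : ℝ) :
    workDone (fun u => g u - h u) t = workDone g t - workDone h t :=
  intervalIntegral.integral_sub (hg t) (hh t)

theorem card_active_intervalIntegrable (S : Schedule I) (a b : ℝ) :
    IntervalIntegrable (fun t => ((S.active t).card : ℝ)) volume a b := by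
  have hm : Measurable fun t => ((S.active t).card : ℝ) :=
    measurable_from_top.comp (measurable_card_active S)
  refine (intervalIntegrable_const (c := (I.size : ℝ))).mono_fun hm.aestronglyMeasurable
    (ae_of_all _ fun t => ?_)
  have h : (S.active t).card ≤ I.size := by simpa using Finset.card_le_univ (S.active t)
  simpa using h

theorem Schedule.speed_nonneg (S : Schedule I) (t : ℝ) : 0 ≤ S.speed t :=
  Finset.sum_nonneg fun j _ => S.rate_nonneg j t

theorem Schedule.speed_rpow_intervalIntegrable {α : ℝ} {S : Schedule I}
    (hS : S.energy α ≠ ∞) {b : ℝ} (hb : 0 ≤ b) :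
    IntervalIntegrable (fun t => S.speed t ^ α) volume 0 b := by
  rw [intervalIntegrable_iff_integrableOn_Ioc_of_le hb]
  have hspeed : IntervalIntegrable S.speed volume 0 b := by
    have := IntervalIntegrable.sum Finset.univ fun j _ => S.rate_integrable j b
    rwa [show (∑ j, S.rate j) = S.speed by funext t; simp [Schedule.speed]] at this
  refine ⟨(hspeed.1.aestronglyMeasurable.aemeasurable.pow_const α).aestronglyMeasurable, ?_⟩
  rw [hasFiniteIntegral_iff_ofReal
    (ae_of_all _ fun t => Real.rpow_nonneg (S.speed_nonneg t) α)]
  exact (lintegral_mono_set fun t ht => ht.1.le).trans_lt hS.lt_top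

/-- The part of the work of the competitor `O` that gains on `S`, weighted by the ranks of the
jobs, is nonnegative in total. -/
theorem integral_rank_mul_lag_nonneg (S O : Schedule I) (j : Fin I.size) {e b : ℝ} (he : 0 ≤ e)
    (hb : 0 ≤ b) :
    0 ≤ ∫ u in (0 : ℝ)..b, (jobRank I.release (S.active u) j : ℝ) ^ e *
      {u | 0 < workDone (fun u => O.rate j u - S.rate j u) u}.indicator
        (fun u => O.rate j u - S.rate j u) u := by
  have hg : ∀ t, IntervalIntegrable (fun u => O.rate j u - S.rate j u) volume 0 t := fun t =>
    (O.rate_integrable j t).sub (S.rate_integrable j t)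
  refine integral_weight_mul_nonneg (F := fun n : ℕ => (n : ℝ) ^ e)
    (ρ := I.release j) (M := I.size) hb ?_ ?_ ?_ ?_ ?_ (measurable_jobRank_active S j) ?_
    (antitoneOn_jobRank_active S j)
  · exact intervalIntegrable_iff.2 ((intervalIntegrable_iff.1 (hg b)).indicator
      (isOpen_lt continuous_const (workDone_continuous hg)).measurableSet)
  · intro u hu
    refine indicator_apply_eq_zero.2 fun _ => ?_
    rw [O.rate_eq_zero j u fun h => h.1.not_gt hu, S.rate_eq_zero j u fun h => h.1.not_gt hu,
      sub_zero]
  · intro T _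
    rw [integral_indicator_pos_eq hg]
    exact le_max_right _ _
  · intro a b hab
    exact Real.rpow_le_rpow (Nat.cast_nonneg _) (Nat.cast_le.2 hab) he
  · exact Real.rpow_nonneg (Nat.cast_nonneg _) _
  · intro u
    exact (jobRank_le_card _ _ _).trans (by simpa using Finset.card_le_univ (S.active u))

theorem rank_mul_lag_intervalIntegrable (S O : Schedule I) (j : Fin I.size) {e : ℝ} (he : 0 ≤ e)
    (b : ℝ) :
    IntervalIntegrable (fun u => (jobRank I.release (S.active u) j : ℝ) ^ e *
      {u | 0 < workDone (fun u => O.rate j u - S.rate j u) u}.indicator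
        (fun u => O.rate j u - S.rate j u) u) volume 0 b := by
  have hg : ∀ t, IntervalIntegrable (fun u => O.rate j u - S.rate j u) volume 0 t := fun t =>
    (O.rate_integrable j t).sub (S.rate_integrable j t)
  have hm : Measurable fun u => (jobRank I.release (S.active u) j : ℝ) ^ e :=
    (measurable_from_top (f := fun n : ℕ => (n : ℝ) ^ e)).comp (measurable_jobRank_active S j)
  rw [intervalIntegrable_iff]
  refine ((intervalIntegrable_iff.1 (hg b)).indicator
    (isOpen_lt continuous_const (workDone_continuous hg)).measurableSet).bdd_mul
    (c := (I.size : ℝ) ^ e) hm.aestronglyMeasurable (ae_of_all _ fun u => ?_)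
  rw [Real.norm_of_nonneg (Real.rpow_nonneg (Nat.cast_nonneg _) _)]
  refine Real.rpow_le_rpow (Nat.cast_nonneg _) (Nat.cast_le.2 ?_) he
  exact (jobRank_le_card _ _ _).trans (by simpa using Finset.card_le_univ (S.active u))

/-- The drift inequality applied to the jobs with positive lag. Such a job is unfinished by LAPS
because the competitor never exceeds its work. An active LAPS job without positive lag is unfinished
by the competitor too. -/
theorem sum_rank_mul_lag_le {α : ℝ} (hα : 1 < α) {S : Schedule I}
    (hS : FollowsLAPS α (3 / α) (1 / (2 * α)) S) (O : Schedule I) (u : ℝ) :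
    ∑ j, (jobRank I.release (S.active u) j : ℝ) ^ (1 - 1 / α) *
      {u | 0 < workDone (fun u => O.rate j u - S.rate j u) u}.indicator
        (fun u => O.rate j u - S.rate j u) u ≤
      O.speed u ^ α / α - 2 / α * (S.active u).card + (2 * α + 6) * (O.active u).card := by
  classical
  have hrate := (followsLAPS_iff (by linarith) (by positivity)
    (by rw [div_le_one (by positivity)]; linarith) S).1 hS u
  let X : Finset (Fin I.size) := Finset.univ.filter fun j =>
    0 < workDone (fun u => O.rate j u - S.rate j u) u
  have hX : ∀ j, j ∈ X ↔ workDone (S.rate j) u < workDone (O.rate j) u := fun j => by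
    simp only [X, Finset.mem_filter, Finset.mem_univ, true_and]
    rw [workDone_sub (O.rate_integrable j) (S.rate_integrable j), sub_pos]
  refine le_trans (le_of_eq ?_) (sum_rank_mul_sub_le (I := I) hα (X := X) (A := S.active u)
    (O := O.active u) ?_ ?_ fun j => O.rate_nonneg j u)
  · rw [Finset.sum_filter]
    refine Finset.sum_congr rfl fun j _ => ?_
    rw [indicator_apply, ← hrate j]
    by_cases h : 0 < workDone (fun u => O.rate j u - S.rate j u) u
    · simp [h]
    · simp [h]
  · intro j hj
    rw [hX] at hj
    refine Schedule.mem_active.2 ⟨?_, hj.trans_le (O.workDone_le_work j u)⟩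
    by_contra! hu
    have hW : ∀ S' : Schedule I, workDone (S'.rate j) u = workDone (fun _ => 0) u := fun S' =>
      workDone_congr_of_lt (I.release_nonneg j) hu.le
        fun v hv => S'.rate_eq_zero j v fun h => h.1.not_gt hv
    rw [hW S, hW O] at hj
    exact hj.false
  · intro j hj hjX
    rw [hX, not_lt] at hjX
    rw [Schedule.mem_active] at hj ⊢
    exact ⟨hj.1, hjX.trans_lt hj.2⟩

theorem integral_card_active_le {α : ℝ} (hα : 1 < α) {S : Schedule I}
    (hS : FollowsLAPS α (3 / α) (1 / (2 * α)) S) {O : Schedule I} (hO : O.energy α ≠ ∞)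
    {b : ℝ} (hb : 0 ≤ b) :
    ∫ u in (0 : ℝ)..b, ((S.active u).card : ℝ) ≤
      ∫ u in (0 : ℝ)..b, 4 * α ^ 3 * (((O.active u).card : ℝ) + O.speed u ^ α) := by
  have hα0 : 0 < α := by linarith
  have he : 0 ≤ 1 - 1 / α := by
    rw [sub_nonneg, div_le_one hα0]
    exact hα.le
  have hint := fun j => rank_mul_lag_intervalIntegrable S O j he b
  have hn := card_active_intervalIntegrable S 0 b
  have ho := card_active_intervalIntegrable O 0 b
  have hs := O.speed_rpow_intervalIntegrable hO hb
  have hsum : IntervalIntegrable (fun u => ∑ j, (jobRank I.release (S.active u) j : ℝ) ^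
      (1 - 1 / α) * {u | 0 < workDone (fun u => O.rate j u - S.rate j u) u}.indicator
        (fun u => O.rate j u - S.rate j u) u) volume 0 b := by
    simpa only [Finset.sum_fn] using IntervalIntegrable.sum Finset.univ fun j _ => hint j
  have hnonneg : 0 ≤ ∫ u in (0 : ℝ)..b, ∑ j, (jobRank I.release (S.active u) j : ℝ) ^
      (1 - 1 / α) * {u | 0 < workDone (fun u => O.rate j u - S.rate j u) u}.indicator
        (fun u => O.rate j u - S.rate j u) u := by
    rw [intervalIntegral.integral_finsetSum fun j _ => hint j]
    exact Finset.sum_nonneg fun j _ => integral_rank_mul_lag_nonneg S O j he hb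
  have hrhs := (ho.add hs).const_mul (4 * α ^ 3)
  have hle : ∫ u in (0 : ℝ)..b, ∑ j, (jobRank I.release (S.active u) j : ℝ) ^
      (1 - 1 / α) * {u | 0 < workDone (fun u => O.rate j u - S.rate j u) u}.indicator
        (fun u => O.rate j u - S.rate j u) u ≤
      ∫ u in (0 : ℝ)..b, 2 / α * (4 * α ^ 3 * (((O.active u).card : ℝ) + O.speed u ^ α) -
        (S.active u).card) := by
    refine intervalIntegral.integral_mono_on hb hsum ((hrhs.sub hn).const_mul _) fun u _ => ?_
    refine (sum_rank_mul_lag_le hα hS O u).trans ?_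
    have hsp := Real.rpow_nonneg (O.speed_nonneg u) α
    have hc : (0 : ℝ) ≤ (O.active u).card := Nat.cast_nonneg _
    -- The constant is `4α³ = (α/2) · 8α²`, where `8α²` dominates both `2α + 6` and `1/α` for `α >
    -- 1`.
    have h1 : 2 / α * (4 * α ^ 3 * (((O.active u).card : ℝ) + O.speed u ^ α) -
        (S.active u).card) = 8 * α ^ 2 * O.speed u ^ α - 2 / α * (S.active u).card +
        8 * α ^ 2 * (O.active u).card := by
      field_simp
      ring
    have h2 : O.speed u ^ α / α ≤ 8 * α ^ 2 * O.speed u ^ α := by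
      rw [div_le_iff₀ hα0]
      have : 1 ≤ 8 * α ^ 2 * α := by nlinarith [mul_pos hα0 hα0]
      nlinarith
    have h3 : (2 * α + 6) * ((O.active u).card : ℝ) ≤ 8 * α ^ 2 * (O.active u).card := by
      gcongr
      nlinarith
    rw [h1]
    linarith
  rw [intervalIntegral.integral_const_mul, intervalIntegral.integral_sub hrhs hn] at hle
  have := nonneg_of_mul_nonneg_right (hnonneg.trans hle) (by positivity)
  linarith

theorem ofReal_intervalIntegral_eq_setLIntegral {f : ℝ → ℝ} {b : ℝ} (hb : 0 ≤ b)
    (hf : IntervalIntegrable f volume 0 b) (h0 : ∀ t, 0 ≤ f t) :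
    ENNReal.ofReal (∫ u in (0 : ℝ)..b, f u) = ∫⁻ u in Ioc 0 b, ENNReal.ofReal (f u) := by
  rw [intervalIntegral.integral_of_le hb]
  exact ofReal_integral_eq_lintegral_ofReal hf.1 (ae_of_all _ h0)

theorem Schedule.lintegral_card_add_speed_rpow (α : ℝ) (O : Schedule I) :
    ∫⁻ t in Ici (0 : ℝ), ENNReal.ofReal (((O.active t).card : ℝ) + O.speed t ^ α) =
      O.cost α := by
  have hm : Measurable fun t => ENNReal.ofReal ((O.active t).card : ℝ) :=
    (measurable_from_top (f := fun n : ℕ => ENNReal.ofReal (n : ℝ))).comp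
      (measurable_card_active O)
  rw [Schedule.cost, O.totalFlow_eq_lintegral, Schedule.energy, ← lintegral_add_left hm]
  refine lintegral_congr fun t => ?_
  exact ENNReal.ofReal_add (Nat.cast_nonneg _) (Real.rpow_nonneg (O.speed_nonneg t) α)

theorem totalFlow_le {α : ℝ} (hα : 1 < α) {S : Schedule I}
    (hS : FollowsLAPS α (3 / α) (1 / (2 * α)) S) (O : Schedule I) :
    S.totalFlow ≤ ENNReal.ofReal (4 * α ^ 3) * O.cost α := by
  have hα0 : 0 < α := by linarith
  have hpos : 0 < 4 * α ^ 3 := by positivity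
  -- Finite energy is needed to integrate `speed ^ α` over bounded intervals; otherwise the bound is
  -- trivial.
  by_cases hO : O.energy α = ∞
  · have : O.cost α = ∞ := by rw [Schedule.cost, hO, add_top]
    rw [this, ENNReal.mul_top (by simpa using hpos)]
    exact le_top
  have hbound : ∀ k : ℕ, ∫⁻ t in Ioc (0 : ℝ) k, ENNReal.ofReal ((S.active t).card : ℝ) ≤
      ENNReal.ofReal (4 * α ^ 3) * O.cost α := by
    intro k
    have hk : (0 : ℝ) ≤ k := Nat.cast_nonneg k
    have hint := ((card_active_intervalIntegrable O 0 k).add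
      (O.speed_rpow_intervalIntegrable hO hk)).const_mul (4 * α ^ 3)
    rw [← ofReal_intervalIntegral_eq_setLIntegral hk (card_active_intervalIntegrable S 0 k)
      fun t => Nat.cast_nonneg _]
    refine (ENNReal.ofReal_le_ofReal (integral_card_active_le hα hS hO hk)).trans ?_
    rw [ofReal_intervalIntegral_eq_setLIntegral hk hint fun t => mul_nonneg hpos.le
      (add_nonneg (Nat.cast_nonneg _) (Real.rpow_nonneg (O.speed_nonneg t) α))]
    simp only [ENNReal.ofReal_mul hpos.le]
    rw [lintegral_const_mul' _ _ ENNReal.ofReal_ne_top, ← O.lintegral_card_add_speed_rpow]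
    gcongr
    exact fun t ht => ht.1.le
  have hunion : ⋃ k : ℕ, Ioc (0 : ℝ) k = Ioi 0 := by
    ext t
    simp only [mem_iUnion, mem_Ioc, mem_Ioi]
    exact ⟨fun ⟨_, h⟩ => h.1, fun h => (exists_nat_ge t).imp fun _ hk => ⟨h, hk⟩⟩
  rw [S.totalFlow_eq_lintegral, setLIntegral_congr Ioi_ae_eq_Ici.symm, ← hunion,
    setLIntegral_iUnion_of_directed]
  · exact iSup_le hbound
  · exact Monotone.directed_le fun a b hab => Ioc_subset_Ioc_right (Nat.cast_le.2 hab)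

/-- The power at each time is `((1 + δ) n^(1/α))^α = (1 + δ)^α n`, a fixed multiple of the rate at
which flow time accrues. -/
theorem cost_eq_of_followsLAPS {α δ β : ℝ} (hα : 0 < α) (hδ : 0 ≤ δ) {S : Schedule I}
    (hS : FollowsLAPS α δ β S) :
    S.cost α = ENNReal.ofReal (1 + (1 + δ) ^ α) * S.totalFlow := by
  have hpow : 0 ≤ (1 + δ) ^ α := by positivity
  have henergy : S.energy α = ENNReal.ofReal ((1 + δ) ^ α) * S.totalFlow := by
    rw [S.totalFlow_eq_lintegral, ← lintegral_const_mul' _ _ ENNReal.ofReal_ne_top]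
    refine lintegral_congr fun t => ?_
    rw [← ENNReal.ofReal_mul hpow, hS.speed_eq,
      Real.mul_rpow (by positivity) (by positivity), ← Real.rpow_mul (Nat.cast_nonneg _),
      one_div_mul_cancel hα.ne', Real.rpow_one]
  rw [Schedule.cost, henergy, ENNReal.ofReal_add zero_le_one hpow, ENNReal.ofReal_one, add_mul,
    one_mul]

theorem cost_le_of_followsLAPS {α : ℝ} (hα : 1 < α) {S : Schedule I}
    (hS : FollowsLAPS α (3 / α) (1 / (2 * α)) S) :
    S.cost α ≤ ENNReal.ofReal (4 * α ^ 3 * (1 + (1 + 3 / α) ^ α)) * optCost α I := by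
  have hα0 : 0 < α := by linarith
  rw [optCost, ENNReal.mul_iInf' (fun h => absurd h ENNReal.ofReal_ne_top) fun _ => ⟨S⟩]
  refine le_iInf fun O => ?_
  rw [cost_eq_of_followsLAPS hα0 (by positivity) hS, mul_comm (4 * α ^ 3),
    ENNReal.ofReal_mul (by positivity), mul_assoc]
  gcongr
  exact totalFlow_le hα hS O

theorem one_add_three_div_rpow_le {α : ℝ} (hα : 0 < α) : (1 + 3 / α) ^ α ≤ Real.exp 3 := by
  calc (1 + 3 / α) ^ α ≤ Real.exp (3 / α) ^ α := by
        gcongr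
        linarith [Real.add_one_le_exp (3 / α)]
    _ = Real.exp 3 := by rw [← Real.exp_mul, div_mul_cancel₀ _ hα.ne']

end Competitive

end SpeedScaling

end

open SpeedScaling in
/-- For every `α > 1`, LAPS(3/α, 1/(2α)) is well defined (for each job sequence exactly one
schedule follows it) and `c`-competitive with `c = 4 α³ (1 + (1 + 3/α) ^ α)`, and `c = O(α³)`. -/
theorem theorem1 :
    (∀ α : ℝ, 1 < α →
      ∃ LAPS : (I : JobSequence) → Schedule I,
        (∀ (I : JobSequence) (S : Schedule I),
          FollowsLAPS α (3 / α) (1 / (2 * α)) S ↔ S = LAPS I) ∧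
        IsCompetitive α (4 * α ^ 3 * (1 + (1 + 3 / α) ^ α)) LAPS) ∧
    ∃ C : ℝ, ∀ α : ℝ, 1 < α → 4 * α ^ 3 * (1 + (1 + 3 / α) ^ α) ≤ C * α ^ 3 := by
  refine ⟨fun α hα => ?_, 4 * (1 + Real.exp 3), fun α hα => ?_⟩
  · have hα0 : 0 < α := by linarith
    choose LAPS hLAPS huniq using fun I => existsUnique_followsLAPS (δ := 3 / α)
      (β := 1 / (2 * α)) hα0 (by positivity) (by positivity)
      (by rw [div_le_one (by positivity)]; linarith) I
    refine ⟨LAPS, fun I S => ⟨huniq I S, fun h => h ▸ hLAPS I⟩, ?_,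
      fun I => cost_le_of_followsLAPS hα (hLAPS I)⟩
    have h1 : 1 ≤ α ^ 3 := one_le_pow₀ hα.le
    have h2 : 0 ≤ (1 + 3 / α) ^ α := by positivity
    nlinarith
  · have hα0 : 0 < α := by linarith
    calc 4 * α ^ 3 * (1 + (1 + 3 / α) ^ α) ≤ 4 * α ^ 3 * (1 + Real.exp 3) := by
          gcongr
          exact one_add_three_div_rpow_le hα0
      _ = 4 * (1 + Real.exp 3) * α ^ 3 := by ring
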